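/- Let $\Omega=(0,1)\times(0,1)$, let $T>0$, and let $\lambda,\mu\in\mathbb R$ satisfy $\mu>0$ and $\lambda+2\mu>0$. Let $I=(\varphi,X,u_0,u_0^*,u_T)$ with $\varphi\in L^1(0,T)$, $X=(X_1,X_2)\in (L^1(0,T;L^1(\partial\Omega)))^2$ and $u_0,u_0^*,u_T\in (L^1(\Omega))^2$. Let $u=(u_1,u_2)\in \big(C^2([0,T];L^2(\Omega))\cap L^2(0,T;H^2(\Omega))\big)^2$ and $f=(f_1,f_2)\in (L^2(\Omega))^2$ satisfy 1. for $j\in\{1,2\}$ and almost every $t\in(0,T)$, $\displaystyle \frac{\partial^2u_j}{\partial t^2}=\mu\Delta u_j+(\lambda+\mu)\frac{\partial}{\partial x_j}\operatorname{div}u+\varphi(t)f_j$ in $L^2(\Omega)$; 2. $u(\cdot,t)=0$ on $\partial\Omega$ in the sense of traces, for almost every $t\in(0,T)$; 3. $u(\cdot,0)=u_0$, $\frac{\partial u}{\partial t}(\cdot,0)=u_0^*$ and $u(\cdot,T)=u_T$ almost everywhere in $\Omega$; 4. with $\sigma_j=\lambda\operatorname{div}u+2\mu\frac{\partial u_j}{\partial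 x_j}$, $\tau=\mu\big(\frac{\partial u_1}{\partial x_2}+\frac{\partial u_2}{\partial x_1}\big)$ and the outward unit normal $n=(n_1,n_2)$, for almost every $t\in(0,T)$, $n_1\sigma_1+n_2\tau=X_1$ and $n_2\sigma_2+n_1\tau=X_2$ almost everywhere on $\partial\Omega$, in the sense of traces. Then for all $\alpha=(\alpha_1,\alpha_2)\in\mathbb R^2\setminus\{0\}$ and all $j\in\{1,2\}$, $$2D(I)\int_\Omega f_j(x)\cos(\alpha\cdot x)\,dx=g_j(I),$$ where $$D(I)=D_1(I)D_2(I),\qquad g_j(I)=\frac{2}{|\alpha|^2}\big(\alpha_jD_2(I)h_0(I)+D_1(I)h_j(I)\big),$$ $$D_1(I)=\int_0^T\varphi(T-t)\sin(\sqrt{\lambda+2\mu}\,|\alpha|t)\,dt,\qquad D_2(I)=\int_0^T\varphi(T-t)\sin(\sqrt{\mu}\,|\alpha|t)\,dt,$$ $$\begin{aligned}h_0(I)={}&-\sin(\sqrt{\lambda+2\mu}|\alpha|T)\int_\Omega(\alpha\cdot u_0^*)\cos(\alpha\cdot x)\,dx+\sqrt{\lambda+2\mu}|\alpha|\int_\Omega(\alpha\cdot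 u_T)\cos(\alpha\cdot x)\,dx\\&-\sqrt{\lambda+2\mu}|\alpha|\cos(\sqrt{\lambda+2\mu}|\alpha|T)\int_\Omega(\alpha\cdot u_0)\cos(\alpha\cdot x)\,dx\\&-\int_0^T\!\!\int_{\partial\Omega}\sin(\sqrt{\lambda+2\mu}|\alpha|(T-t))(\alpha\cdot X)\cos(\alpha\cdot x)\,d\omega\,dt,\end{aligned}$$ $$\begin{aligned}h_j(I)={}&-\sin(\sqrt{\mu}|\alpha|T)\int_\Omega(|\alpha|^2u_{0j}^*-\alpha_j(\alpha\cdot u_0^*))\cos(\alpha\cdot x)\,dx+\sqrt{\mu}|\alpha|\int_\Omega(|\alpha|^2u_{Tj}-\alpha_j(\alpha\cdot u_T))\cos(\alpha\cdot x)\,dx\\&-\sqrt{\mu}|\alpha|\cos(\sqrt{\mu}|\alpha|T)\int_\Omega(|\alpha|^2u_{0j}-\alpha_j(\alpha\cdot u_0))\cos(\alpha\cdot x)\,dx\\&-\int_0^T\!\!\int_{\partial\Omega}\sin(\sqrt{\mu}|\alpha|(T-t))(|\alpha|^2X_j-\alpha_j(\alpha\cdot X))\cos(\alpha\cdot x)\,d\omega\,dt.\end{aligned}$$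 Here $d\omega$ is arc length on $\partial\Omega$. -/

import Mathlib

open MeasureTheory Set Filter Topology
open scoped ContDiff

noncomputable section

namespace Elastic

/-- The Euclidean plane. -/
abbrev Plane : Type := EuclideanSpace ℝ (Fin 2)

/-- The `i`-th standard basis vector. -/
def basisVec (i : Fin 2) : Plane := EuclideanSpace.single i 1

/-- The open unit square `Ω = (0, 1) × (0, 1)`. -/
def square : Set Plane := {x | ∀ i, x i ∈ Ioo (0 : ℝ) 1}

/-- Lebesgue measure on the square. -/
def area : Measure Plane := volume.restrict square

/-- Arc length on the boundary of the square. -/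
def arcLength : Measure Plane := (Measure.hausdorffMeasure 1).restrict (frontier square)

/-- Lebesgue measure on the time interval `(0, T)`. -/
def time (T : ℝ) : Measure ℝ := volume.restrict (Ioo 0 T)

/-- The outward unit normal of the square at a boundary point other than a corner
(the corners are a null set for `arcLength`). -/
def normal (i : Fin 2) (x : Plane) : ℝ :=
  if x i = 1 then 1 else if x i = 0 then -1 else 0

/-- The space `L²(Ω)`. -/
abbrev L2 : Type := Lp ℝ 2 area

/-- `w'` is the weak partial derivative of `w` in the direction `x_i` on the square. -/
def IsWeakDeriv (i : Fin 2) (w w' : L2) : Prop :=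
  ∀ ψ : Plane → ℝ, ContDiff ℝ ∞ ψ → HasCompactSupport ψ → tsupport ψ ⊆ square →
    ∫ x, w x * fderiv ℝ ψ x (basisVec i) ∂area = -∫ x, w' x * ψ x ∂area

theorem integrable_mul_test (w : L2) {ψ : Plane → ℝ} (hψ : Continuous ψ)
    (hc : HasCompactSupport ψ) : Integrable (fun x => w x * ψ x) area := by
  have h : MemLp ψ 2 area := (hψ.memLp_of_hasCompactSupport hc).restrict _
  exact (Lp.memLp w).integrable_mul h

theorem integrable_mul_fderiv_test (i : Fin 2) (w : L2) {ψ : Plane → ℝ}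
    (hψ : ContDiff ℝ ∞ ψ) (hc : HasCompactSupport ψ) :
    Integrable (fun x => w x * fderiv ℝ ψ x (basisVec i)) area :=
  integrable_mul_test w ((hψ.continuous_fderiv (by simp)).clm_apply continuous_const)
    (hc.fderiv_apply ℝ (basisVec i))

theorem IsWeakDeriv.zero (i : Fin 2) : IsWeakDeriv i 0 0 := by
  intro ψ _ _ _
  have key : ∀ (z : L2) (θ : Plane → ℝ), z = 0 → ∫ x, z x * θ x ∂area = 0 := by
    intro z θ hz
    refine integral_eq_zero_of_ae ?_
    have hz' : ⇑z =ᵐ[area] 0 := hz ▸ Lp.coeFn_zero ℝ 2 area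
    filter_upwards [hz'] with x hx
    simp [hx]
  rw [key _ _ rfl, key _ _ rfl, neg_zero]

theorem IsWeakDeriv.add {i : Fin 2} {v v' w w' : L2} (hv : IsWeakDeriv i v v')
    (hw : IsWeakDeriv i w w') : IsWeakDeriv i (v + w) (v' + w') := by
  intro ψ h1 h2 h3
  have key : ∀ (a b : L2) (θ : Plane → ℝ), Integrable (fun x => a x * θ x) area →
      Integrable (fun x => b x * θ x) area →
      ∫ x, (a + b : L2) x * θ x ∂area = ∫ x, a x * θ x ∂area + ∫ x, b x * θ x ∂area := by
    intro a b θ ha hb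
    rw [← integral_add ha hb]
    refine integral_congr_ae ?_
    filter_upwards [Lp.coeFn_add a b] with x hx
    rw [hx, Pi.add_apply, add_mul]
  rw [key v w _ (integrable_mul_fderiv_test i v h1 h2) (integrable_mul_fderiv_test i w h1 h2),
    key v' w' _ (integrable_mul_test v' h1.continuous h2) (integrable_mul_test w' h1.continuous h2),
    hv ψ h1 h2 h3, hw ψ h1 h2 h3, neg_add]

theorem IsWeakDeriv.smul {i : Fin 2} {w w' : L2} (c : ℝ) (hw : IsWeakDeriv i w w') :
    IsWeakDeriv i (c • w) (c • w') := by
  intro ψ h1 h2 h3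
  have key : ∀ (a : L2) (θ : Plane → ℝ),
      ∫ x, (c • a : L2) x * θ x ∂area = c * ∫ x, a x * θ x ∂area := by
    intro a θ
    rw [← integral_const_mul]
    refine integral_congr_ae ?_
    filter_upwards [Lp.coeFn_smul c a] with x hx
    rw [hx, Pi.smul_apply, smul_eq_mul, mul_assoc]
  rw [key, key, hw ψ h1 h2 h3, mul_neg]

/-- The Sobolev space `H¹(Ω)`: a function of `L²(Ω)` together with its (unique) weak partial
derivatives in `L²(Ω)`. The inherited norm is the largest of the `L²` norms of the function and
of its derivatives, which is equivalent to the usual one. -/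
def H1 : Submodule ℝ (L2 × (Fin 2 → L2)) where
  carrier := {p | ∀ i, IsWeakDeriv i p.1 (p.2 i)}
  zero_mem' := fun i => IsWeakDeriv.zero i
  add_mem' := fun hp hq i => (hp i).add (hq i)
  smul_mem' := fun c _ hp i => (hp i).smul c

/-- The function in `L²(Ω)` underlying an element of `H¹(Ω)`. -/
def H1.fn (w : H1) : L2 := w.1.1

/-- The weak derivative `∂w/∂x_i` of `w ∈ H¹(Ω)`. -/
def H1.deriv (i : Fin 2) (w : H1) : L2 := w.1.2 i

/-- The Sobolev space `H²(Ω)`: a function of `L²(Ω)` together with its weak partial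
derivatives, which lie in `H¹(Ω)`; again with (a norm equivalent to) the usual norm. -/
def H2 : Submodule ℝ (L2 × (Fin 2 → H1)) where
  carrier := {p | ∀ i, IsWeakDeriv i p.1 (H1.fn (p.2 i))}
  zero_mem' := fun i => IsWeakDeriv.zero i
  add_mem' := fun hp hq i => (hp i).add (hq i)
  smul_mem' := fun c _ hp i => (hp i).smul c

/-- The function in `L²(Ω)` underlying an element of `H²(Ω)`. -/
def H2.fn (w : H2) : L2 := w.1.1

/-- The weak derivative `∂w/∂x_i` of `w ∈ H²(Ω)`, an element of `H¹(Ω)`. -/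
def H2.deriv (i : Fin 2) (w : H2) : H1 := w.1.2 i

/-- `w ∈ H²(Ω)` regarded as an element of `H¹(Ω)`. -/
def H2.toH1 (w : H2) : H1 := ⟨(H2.fn w, fun i => H1.fn (H2.deriv i w)), w.2⟩

/-- `γ ∈ L²(∂Ω)` is the trace of `w ∈ H¹(Ω)` on the boundary: `(w, γ)` is a limit, in
`H¹(Ω) × L²(∂Ω)`, of pairs `(p|_Ω, p|_∂Ω)` with `p` smooth up to the boundary. -/
def HasTrace (w : H1) (γ : Lp ℝ 2 arcLength) : Prop :=
  ∃ p : ℕ → Plane → ℝ, (∀ n, ContDiff ℝ ∞ (p n)) ∧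
    Tendsto (fun n => eLpNorm (fun x => p n x - H1.fn w x) 2 area) atTop (𝓝 0) ∧
    (∀ i, Tendsto (fun n => eLpNorm
      (fun x => fderiv ℝ (p n) x (basisVec i) - H1.deriv i w x) 2 area) atTop (𝓝 0)) ∧
    Tendsto (fun n => eLpNorm (fun x => p n x - γ x) 2 arcLength) atTop (𝓝 0)

/-- The Laplacian of `w ∈ H²(Ω)`. -/
def laplacian (w : H2) : L2 := ∑ i, H1.deriv i (H2.deriv i w)

/-- The divergence of a vector field with components in `H²(Ω)`. -/
def divergence (v : Fin 2 → H2) : H1 := ∑ i, H2.deriv i (v i)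

/-- The shear stress `τ = μ (∂u₁/∂x₂ + ∂u₂/∂x₁)`. -/
def shearStress (μ : ℝ) (v : Fin 2 → H2) : H1 :=
  μ • (H2.deriv 1 (v 0) + H2.deriv 0 (v 1))

/-- The normal stress `σ_j = λ div u + 2 μ ∂u_j/∂x_j`. -/
def normalStress (lam μ : ℝ) (v : Fin 2 → H2) (j : Fin 2) : H1 :=
  lam • divergence v + (2 * μ) • H2.deriv j (v j)

/-- The data `I = (φ, X, u₀, u₀*, u_T)` of the problem. -/
structure Data (T : ℝ) where
  /-- the time factor of the body force, in `L¹(0, T)` -/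
  φ : Lp ℝ 1 (time T)
  /-- the surface stress, in `L¹(0, T; L¹(∂Ω))²` -/
  X : Fin 2 → Lp (Lp ℝ 1 arcLength) 1 (time T)
  /-- the initial displacement, in `L¹(Ω)²` -/
  u₀ : Fin 2 → Lp ℝ 1 area
  /-- the initial velocity, in `L¹(Ω)²` -/
  v₀ : Fin 2 → Lp ℝ 1 area
  /-- the final displacement, in `L¹(Ω)²` -/
  uT : Fin 2 → Lp ℝ 1 area

/-- `u` belongs to `(C²([0, T]; L²(Ω)) ∩ L²(0, T; H²(Ω)))²`, where `U` is the class of `u` in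
`L²(0, T; H²(Ω))²`. -/
structure IsAdmissible (T : ℝ) (u : Fin 2 → ℝ → L2) (U : Fin 2 → ℝ → H2) : Prop where
  contDiffOn : ∀ j, ContDiffOn ℝ 2 (u j) (Icc 0 T)
  memLp : ∀ j, MemLp (U j) 2 (time T)
  fn_eq : ∀ j, ∀ᵐ t ∂time T, H2.fn (U j t) = u j t

/-- `(u, f)` solves the inverse source problem for the Lamé system with data `I`. The function
`U` is `u` as an `H²(Ω)`-valued function. -/
structure IsSolution (lam μ : ℝ) {T : ℝ} (I : Data T) (u : Fin 2 → ℝ → L2)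
    (U : Fin 2 → ℝ → H2) (f : Fin 2 → L2) : Prop where
  /-- the Lamé system -/
  equation : ∀ j, ∀ᵐ t ∂time T, iteratedDerivWithin 2 (u j) (Icc 0 T) t =
    μ • laplacian (U j t) + (lam + μ) • H1.deriv j (divergence fun i => U i t) + I.φ t • f j
  /-- the clamped boundary -/
  clamped : ∀ j, ∀ᵐ t ∂time T, HasTrace (H2.toH1 (U j t)) 0
  /-- the initial displacement -/
  initial : ∀ j, ⇑(u j 0) =ᵐ[area] ⇑(I.u₀ j)
  /-- the initial velocity -/
  velocity : ∀ j, ⇑(derivWithin (u j) (Icc 0 T) 0) =ᵐ[area] ⇑(I.v₀ j)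
  /-- the final displacement -/
  final : ∀ j, ⇑(u j T) =ᵐ[area] ⇑(I.uT j)
  /-- the surface stress: `n₁ σ₁ + n₂ τ = X₁` and `n₂ σ₂ + n₁ τ = X₂` on the boundary -/
  stress : ∀ᵐ t ∂time T, ∃ σ₁ σ₂ τ : Lp ℝ 2 arcLength,
    HasTrace (normalStress lam μ (fun i => U i t) 0) σ₁ ∧
    HasTrace (normalStress lam μ (fun i => U i t) 1) σ₂ ∧
    HasTrace (shearStress μ fun i => U i t) τ ∧
    (∀ᵐ x ∂arcLength, normal 0 x * σ₁ x + normal 1 x * τ x = I.X 0 t x) ∧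
    (∀ᵐ x ∂arcLength, normal 1 x * σ₂ x + normal 0 x * τ x = I.X 1 t x)

/-- `α · w` at the point `x`, for a vector field `w` given by its components. -/
def dot (α : Plane) (w : Fin 2 → Plane → ℝ) (x : Plane) : ℝ := ∑ i, α i * w i x

/-- `|α|² w_j - α_j (α · w)` at the point `x`. -/
def perp (α : Plane) (j : Fin 2) (w : Fin 2 → Plane → ℝ) (x : Plane) : ℝ :=
  ‖α‖ ^ 2 * w j x - α j * dot α w x

/-- The plane wave `cos (α · x)`. -/
def wave (α x : Plane) : ℝ := Real.cos (inner ℝ α x)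

variable {T : ℝ}

/-- `D₁(I)`. -/
def D₁ (lam μ : ℝ) (I : Data T) (α : Plane) : ℝ :=
  ∫ t in Ioo 0 T, I.φ (T - t) * Real.sin (√(lam + 2 * μ) * ‖α‖ * t)

/-- `D₂(I)`. -/
def D₂ (μ : ℝ) (I : Data T) (α : Plane) : ℝ :=
  ∫ t in Ioo 0 T, I.φ (T - t) * Real.sin (√μ * ‖α‖ * t)

/-- `D(I) = D₁(I) D₂(I)`. -/
def D (lam μ : ℝ) (I : Data T) (α : Plane) : ℝ := D₁ lam μ I α * D₂ μ I α

/-- `h₀(I)`. -/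
def h₀ (lam μ : ℝ) (I : Data T) (α : Plane) : ℝ :=
  -Real.sin (√(lam + 2 * μ) * ‖α‖ * T) *
      ∫ x, dot α (fun i => ⇑(I.v₀ i)) x * wave α x ∂area
    + √(lam + 2 * μ) * ‖α‖ * ∫ x, dot α (fun i => ⇑(I.uT i)) x * wave α x ∂area
    - √(lam + 2 * μ) * ‖α‖ * Real.cos (√(lam + 2 * μ) * ‖α‖ * T) *
      ∫ x, dot α (fun i => ⇑(I.u₀ i)) x * wave α x ∂area
    - ∫ t in Ioo 0 T, ∫ x, Real.sin (√(lam + 2 * μ) * ‖α‖ * (T - t)) *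
        dot α (fun i => ⇑(I.X i t)) x * wave α x ∂arcLength

/-- `h_j(I)` for `j ∈ {1, 2}`. -/
def h (μ : ℝ) (I : Data T) (α : Plane) (j : Fin 2) : ℝ :=
  -Real.sin (√μ * ‖α‖ * T) * ∫ x, perp α j (fun i => ⇑(I.v₀ i)) x * wave α x ∂area
    + √μ * ‖α‖ * ∫ x, perp α j (fun i => ⇑(I.uT i)) x * wave α x ∂area
    - √μ * ‖α‖ * Real.cos (√μ * ‖α‖ * T) *
      ∫ x, perp α j (fun i => ⇑(I.u₀ i)) x * wave α x ∂area
    - ∫ t in Ioo 0 T, ∫ x, Real.sin (√μ * ‖α‖ * (T - t)) *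
        perp α j (fun i => ⇑(I.X i t)) x * wave α x ∂arcLength

/-- `g_j(I)`. -/
def g (lam μ : ℝ) (I : Data T) (α : Plane) (j : Fin 2) : ℝ :=
  2 / ‖α‖ ^ 2 * (α j * D₂ μ I α * h₀ lam μ I α + D₁ lam μ I α * h μ I α j)

end Elastic

end

/-! A plane wave `a cos (α · x)` whose polarization `a` is an eigenvector of the symbol,
`(λ+μ)(a·α)α + μ|α|²a = ν²a`, decouples the system. Two integrations by parts applied to the Lamé
operator, the divergence of the stress, move it onto the wave. The first leaves the surface stress
`X` on the boundary, and the second leaves nothing because `u` has zero trace. So `y(t) = ∫ (a·u)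
cos (α·x)` satisfies `y'' + ν²y = φ(t) ∫ (a·f) cos (α·x) + ∫ (a·X) cos (α·x) dω`.

Integrating this against `sin (ν(T-t))` expresses `∫ (a·f) cos (α·x)`, times the integral of `φ(T-t)
sin (νt)`, through `y(0)`, `y'(0)`, `y(T)` and `X` (`modal_identity`). The longitudinal choice `a =
α` has `ν² = (λ+2μ)|α|²` and gives `h₀ = D₁ (α·F)`, where `F` is the vector of cosine coefficients
of `f`. The transversal choice `a = |α|²e_j - α_jα` has `ν² = μ|α|²` and gives `h_j = D₂ (|α|²F_j -
α_j(α·F))`. In `g_j` the terms in `α·F` cancel.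

The analytic core is `HasTrace.integral_deriv_mul`, obtained from the divergence theorem for smooth
functions by a limit, and `cosCoeff_lame`, which computes the symbol. -/

noncomputable section

namespace Elastic

/-! ### The sides of the square and their arc length -/

/-- The point of the plane whose `i`-th coordinate is `s` and whose other coordinate is `r`. -/
def point (i : Fin 2) (s r : ℝ) : Plane := WithLp.toLp 2 fun k => if k = i then s else r

/-- The side of the closed unit square on which `x_i = s`. -/
def edge (i : Fin 2) (s : ℝ) : Set Plane := {x | x i = s ∧ ∀ k, k ≠ i → x k ∈ Icc (0 : ℝ) 1}

theorem isOpen_square : IsOpen square := by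
  have : square = ⋂ i : Fin 2, {x : Plane | x i ∈ Ioo (0 : ℝ) 1} := by ext; simp [square]
  rw [this]
  exact isOpen_iInter_of_finite fun i => isOpen_Ioo.preimage (by fun_prop)

theorem closure_square : closure square = {x : Plane | ∀ i, x i ∈ Icc (0 : ℝ) 1} := by
  let e : Plane ≃ₜ (Fin 2 → ℝ) := (EuclideanSpace.equiv (Fin 2) ℝ).toHomeomorph
  have h1 : square = e ⁻¹' (Set.pi univ fun _ => Ioo (0 : ℝ) 1) := by
    ext x; simp only [square, mem_ofPred_eq, mem_preimage, mem_univ_pi]; rfl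
  rw [h1, ← e.preimage_closure, closure_pi_set]
  ext x
  simp only [closure_Ioo (zero_ne_one' ℝ), mem_preimage, mem_univ_pi, mem_ofPred_eq]; rfl

theorem frontier_inter_eq_edge (i : Fin 2) {s : ℝ} (hs : s = 0 ∨ s = 1) :
    frontier square ∩ {x | x i = s} = edge i s := by
  rw [isOpen_square.frontier_eq, closure_square]
  ext x
  simp only [square, edge, mem_inter_iff, Set.mem_sdiff, mem_ofPred_eq]
  constructor
  · rintro ⟨⟨h1, -⟩, h2⟩
    exact ⟨h2, fun k _ => h1 k⟩
  · rintro ⟨h1, h2⟩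
    refine ⟨⟨fun k => ?_, fun h => ?_⟩, h1⟩
    · by_cases hk : k = i
      · subst hk; rw [h1]; rcases hs with rfl | rfl <;> simp
      · exact h2 k hk
    · have := h i
      rw [h1] at this
      rcases hs with rfl | rfl <;> simp at this

theorem isometry_point (i : Fin 2) (s : ℝ) : Isometry (point i s) := by
  refine Isometry.of_dist_eq fun a b => ?_
  rw [EuclideanSpace.dist_eq, Real.dist_eq, ← Real.sqrt_sq_eq_abs]
  fin_cases i <;> simp [point, Fin.sum_univ_two, Real.dist_eq, sq_abs]

theorem continuous_point (i : Fin 2) : Continuous fun z : ℝ × ℝ => point i z.1 z.2 := by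
  refine (PiLp.continuous_toLp 2 _).comp (continuous_pi fun k => ?_)
  split_ifs <;> fun_prop

theorem point_mem_edge_iff (i : Fin 2) (s r : ℝ) : point i s r ∈ edge i s ↔ r ∈ Icc (0 : ℝ) 1 := by
  fin_cases i <;> simp [point, edge]

theorem edge_subset_range (i : Fin 2) (s : ℝ) : edge i s ⊆ range (point i s) := by
  rintro x ⟨h, -⟩
  refine ⟨x (i + 1), ?_⟩
  ext k
  fin_cases i <;> fin_cases k <;> simp_all [point]

theorem measurableSet_edge (i : Fin 2) (s : ℝ) : MeasurableSet (edge i s) := by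
  have : edge i s = {x : Plane | x i = s} ∩ ⋂ k : Fin 2, ⋂ _ : k ≠ i, {x : Plane | x k ∈ Icc (0:ℝ) 1} := by
    ext; simp [edge]
  rw [this]
  refine (isClosed_eq (by fun_prop) continuous_const).measurableSet.inter ?_
  exact MeasurableSet.iInter fun k => MeasurableSet.iInter fun _ =>
    (isClosed_Icc.preimage (f := fun x : Plane => x k) (by fun_prop)).measurableSet

/-- The parametrization of a side is an isometry, so it transports one-dimensional Hausdorff
measure, which on the line is Lebesgue measure. -/
theorem map_point_restrict (i : Fin 2) (s : ℝ) :
    (volume.restrict (Icc (0 : ℝ) 1)).map (point i s) =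
      (Measure.hausdorffMeasure 1).restrict (edge i s) := by
  have he : MeasurableEmbedding (point i s) :=
    (isometry_point i s).isClosedEmbedding.measurableEmbedding
  have h1 : Icc (0 : ℝ) 1 = point i s ⁻¹' edge i s := by
    ext r; rw [mem_preimage, point_mem_edge_iff]
  rw [h1, ← he.restrict_map, ← hausdorffMeasure_real,
    (isometry_point i s).map_hausdorffMeasure (Or.inl zero_le_one),
    Measure.restrict_restrict (measurableSet_edge i s),
    inter_eq_self_of_subset_left (edge_subset_range i s)]

theorem setIntegral_edge (i : Fin 2) {s : ℝ} (hs : s = 0 ∨ s = 1) (F : Plane → ℝ) :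
    ∫ x in {x : Plane | x i = s}, F x ∂arcLength = ∫ r in Icc (0 : ℝ) 1, F (point i s r) := by
  have hm : MeasurableSet {x : Plane | x i = s} :=
    (isClosed_eq (by fun_prop) continuous_const).measurableSet
  rw [arcLength, Measure.restrict_restrict hm, inter_comm, frontier_inter_eq_edge i hs,
    ← map_point_restrict,
    (isometry_point i s).isClosedEmbedding.measurableEmbedding.integral_map]

instance : IsFiniteMeasure arcLength := by
  constructor
  have hsub : frontier square ⊆ ⋃ i : Fin 2, (edge i 0 ∪ edge i 1) := by
    intro x hx
    have hx' := hx
    rw [isOpen_square.frontier_eq, closure_square] at hx'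
    obtain ⟨h1, h2⟩ := hx'
    simp only [square, mem_ofPred_eq, not_forall] at h1 h2
    obtain ⟨i, hi⟩ := h2
    refine mem_iUnion.2 ⟨i, ?_⟩
    rw [← frontier_inter_eq_edge i (Or.inl rfl), ← frontier_inter_eq_edge i (Or.inr rfl)]
    have h3 := h1 i
    by_cases h0 : x i = 0
    · exact Or.inl ⟨hx, h0⟩
    · refine Or.inr ⟨hx, ?_⟩
      by_contra h4
      exact hi ⟨lt_of_le_of_ne h3.1 (Ne.symm h0), lt_of_le_of_ne h3.2 h4⟩
  rw [arcLength, Measure.restrict_apply_univ]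
  refine (measure_mono hsub).trans_lt ?_
  have hfin : ∀ i s, (Measure.hausdorffMeasure 1 : Measure Plane) (edge i s) < ⊤ := by
    intro i s
    rw [← Measure.restrict_apply_univ, ← map_point_restrict,
      Measure.map_apply (isometry_point i s).continuous.measurable MeasurableSet.univ]
    simp
  refine (measure_iUnion_le _).trans_lt ?_
  rw [tsum_fintype]
  exact ENNReal.sum_lt_top.2 fun i _ => measure_union_lt_top (hfin i 0) (hfin i 1)

theorem isCompact_closure_square : IsCompact (closure square) := by
  rw [closure_square]
  let e : Plane ≃ₜ (Fin 2 → ℝ) := (EuclideanSpace.equiv (Fin 2) ℝ).toHomeomorph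
  have : {x : Plane | ∀ i, x i ∈ Icc (0 : ℝ) 1} = e ⁻¹' (Set.pi univ fun _ => Icc (0 : ℝ) 1) := by
    ext x; simp only [mem_ofPred_eq, mem_preimage, mem_univ_pi]; rfl
  rw [this, e.isCompact_preimage]
  exact isCompact_univ_pi fun _ => isCompact_Icc

instance : IsFiniteMeasure area :=
  ⟨by
    rw [area, Measure.restrict_apply_univ]
    exact (measure_mono subset_closure).trans_lt isCompact_closure_square.measure_lt_top⟩

/-! ### The divergence theorem on the square -/

theorem measurable_normal (i : Fin 2) : Measurable (normal i) := by
  have h : ∀ s : ℝ, MeasurableSet {x : Plane | x i = s} := fun s =>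
    (isClosed_eq (by fun_prop) continuous_const).measurableSet
  exact Measurable.ite (h 1) measurable_const (Measurable.ite (h 0) measurable_const measurable_const)

theorem abs_normal_le (i : Fin 2) (x : Plane) : |normal i x| ≤ 1 := by
  unfold normal; split_ifs <;> simp

theorem memLp_of_continuous_area {F : Plane → ℝ} (hF : Continuous F) (p : ENNReal) :
    MemLp F p area := by
  obtain ⟨C, hC⟩ := isCompact_closure_square.exists_bound_of_continuousOn hF.continuousOn
  refine MemLp.of_bound hF.aestronglyMeasurable C ?_
  filter_upwards [ae_restrict_mem isOpen_square.measurableSet] with x hx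
  exact hC x (subset_closure hx)

theorem memLp_of_continuous_arcLength {F : Plane → ℝ} (hF : Continuous F) (p : ENNReal) :
    MemLp F p arcLength := by
  obtain ⟨C, hC⟩ := isCompact_closure_square.exists_bound_of_continuousOn hF.continuousOn
  refine MemLp.of_bound hF.aestronglyMeasurable C ?_
  filter_upwards [ae_restrict_mem isClosed_frontier.measurableSet] with x hx
  exact hC x (frontier_subset_closure hx)

/-- `normal i` is, at every point of the boundary, the indicator of `x_i = 1` minus that of `x_i =
0`, so only two opposite sides contribute. The corners need no exception, since these lines cut the
frontier in full closed sides. -/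
theorem integral_normal_mul (i : Fin 2) {F : Plane → ℝ} (hF : Integrable F arcLength) :
    ∫ x, normal i x * F x ∂arcLength =
      (∫ r in Icc (0 : ℝ) 1, F (point i 1 r)) - ∫ r in Icc (0 : ℝ) 1, F (point i 0 r) := by
  have hm : ∀ s : ℝ, MeasurableSet {x : Plane | x i = s} := fun s =>
    (isClosed_eq (by fun_prop) continuous_const).measurableSet
  rw [← setIntegral_edge i (Or.inr rfl), ← setIntegral_edge i (Or.inl rfl),
    ← integral_indicator (hm 1), ← integral_indicator (hm 0),
    ← integral_sub (hF.indicator (hm 1)) (hF.indicator (hm 0))]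
  refine integral_congr_ae (ae_of_all _ fun x => ?_)
  by_cases h1 : x i = 1
  · simp [normal, h1, indicator]
  · by_cases h0 : x i = 0 <;> simp [normal, h1, h0, indicator]

theorem measurePreserving_point (i : Fin 2) :
    MeasurePreserving (fun z : ℝ × ℝ => point i z.1 z.2) volume volume := by
  have h0 : MeasurePreserving (fun z : ℝ × ℝ => point 0 z.1 z.2) volume volume := by
    have h : (fun z : ℝ × ℝ => point 0 z.1 z.2) =
        WithLp.toLp 2 ∘ MeasurableEquiv.finTwoArrow.symm := by
      funext z
      ext k
      fin_cases k <;> simp [point, MeasurableEquiv.finTwoArrow]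
    rw [h]
    exact (PiLp.volume_preserving_toLp (Fin 2)).comp (volume_preserving_finTwoArrow ℝ).symm
  have h1 : MeasurePreserving (fun z : ℝ × ℝ => point 1 z.1 z.2) volume volume := by
    have h : (fun z : ℝ × ℝ => point 1 z.1 z.2) =
        (fun z : ℝ × ℝ => point 0 z.1 z.2) ∘ Prod.swap := by
      funext z
      ext k
      fin_cases k <;> simp [point]
    rw [h]
    exact h0.comp Measure.measurePreserving_swap
  fin_cases i
  exacts [h0, h1]

theorem measurableEmbedding_point (i : Fin 2) :
    MeasurableEmbedding fun z : ℝ × ℝ => point i z.1 z.2 := by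
  refine (continuous_point i).measurableEmbedding fun z w hzw => ?_
  have h0 := congrArg (fun x : Plane => x 0) hzw
  have h1 := congrArg (fun x : Plane => x 1) hzw
  fin_cases i <;> simp [point] at h0 h1 <;> ext <;> assumption

theorem integral_area_eq (i : Fin 2) {F : Plane → ℝ} (hF : Continuous F) :
    ∫ x, F x ∂area = ∫ r in Icc (0 : ℝ) 1, ∫ s in (0 : ℝ)..1, F (point i s r) := by
  have hpre : (fun z : ℝ × ℝ => point i z.1 z.2) ⁻¹' square = Ioo (0 : ℝ) 1 ×ˢ Ioo (0 : ℝ) 1 := by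
    ext z
    fin_cases i <;> simp [point, square, and_comm]
  rw [area, ← (measurePreserving_point i).setIntegral_preimage_emb (measurableEmbedding_point i),
    hpre, Measure.volume_eq_prod, ← Measure.prod_restrict, integral_prod_symm,
    integral_Icc_eq_integral_Ioo]
  · refine integral_congr_ae (ae_of_all _ fun r => ?_)
    simp only [intervalIntegral.integral_of_le zero_le_one, integral_Ioc_eq_integral_Ioo]
  · rw [Measure.prod_restrict, ← Measure.volume_eq_prod, ← IntegrableOn]
    exact ((hF.comp (continuous_point i)).continuousOn.integrableOn_compact
      (isCompact_Icc.prod isCompact_Icc)).mono_set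
        (prod_mono Ioo_subset_Icc_self Ioo_subset_Icc_self)

theorem hasDerivAt_point (i : Fin 2) (s r : ℝ) :
    HasDerivAt (fun s => point i s r) (basisVec i) s := by
  have h : (fun s => point i s r) = fun s => s • basisVec i + point i 0 r := by
    funext s
    ext k
    fin_cases i <;> fin_cases k <;> simp [point, basisVec]
  rw [h]
  simpa using ((hasDerivAt_id s).smul_const (basisVec i)).add_const (point i 0 r)

/-- The divergence theorem on the square. -/
theorem integral_fderiv_area (i : Fin 2) {F : Plane → ℝ} (hF : ContDiff ℝ 1 F) :
    ∫ x, fderiv ℝ F x (basisVec i) ∂area = ∫ x, normal i x * F x ∂arcLength := by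
  have hc : Continuous fun x => fderiv ℝ F x (basisVec i) :=
    (hF.continuous_fderiv one_ne_zero).clm_apply continuous_const
  have hi : ∀ s, IntegrableOn (fun r => F (point i s r)) (Icc 0 1) := fun s =>
    (hF.continuous.comp (isometry_point i s).continuous).continuousOn.integrableOn_compact
      isCompact_Icc
  -- By Fubini both sides become integrals over the slices parallel to the `i`-th axis, and on each
  -- slice the claim is the fundamental theorem of calculus.
  rw [integral_normal_mul i ((memLp_of_continuous_arcLength hF.continuous 1).integrable le_rfl),
    integral_area_eq i hc, ← integral_sub (hi 1) (hi 0)]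
  refine integral_congr_ae (ae_of_all _ fun r => ?_)
  refine intervalIntegral.integral_eq_sub_of_hasDerivAt (f := fun s => F (point i s r))
    (fun s _ => ?_) ?_
  · exact ((hF.differentiable one_ne_zero _).hasFDerivAt).comp_hasDerivAt s (hasDerivAt_point i s r)
  · exact (hc.comp ((continuous_point i).comp (by fun_prop : Continuous fun s : ℝ => (s, r)))).intervalIntegrable _ _

/-! ### Integration by parts in `H¹(Ω)` -/

/-- Hölder's inequality bounds the `L¹` norm of `c (q n - w)` by the product of the `L²` norms. This
serves the three kinds of convergence in `HasTrace`. -/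
theorem tendsto_integral_mul_of_eLpNorm_two {Y : Type*} [MeasurableSpace Y] {ν : Measure Y}
    {q : ℕ → Y → ℝ} {w c : Y → ℝ} (hq : ∀ n, MemLp (q n) 2 ν) (hw : MemLp w 2 ν)
    (hc : MemLp c 2 ν)
    (h : Tendsto (fun n => eLpNorm (fun y => q n y - w y) 2 ν) atTop (𝓝 0)) :
    Tendsto (fun n => ∫ y, q n y * c y ∂ν) atTop (𝓝 (∫ y, w y * c y ∂ν)) := by
  refine tendsto_integral_of_L1' _ (hw.1.mul hc.1)
    (Eventually.of_forall fun n => (hq n).integrable_mul hc) ?_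
  have h2 : Tendsto (fun n => eLpNorm (fun y => q n y - w y) 2 ν * eLpNorm c 2 ν) atTop (𝓝 0) := by
    simpa using ENNReal.Tendsto.mul_const h (Or.inr hc.2.ne)
  refine tendsto_of_tendsto_of_tendsto_of_le_of_le tendsto_const_nhds h2 (fun n => zero_le) ?_
  intro n
  have e : (fun y => q n y * c y) - w * c = c • (q n - w) := by
    funext y
    simp only [Pi.sub_apply, Pi.smul_apply', smul_eq_mul, Pi.mul_apply]
    ring
  have := eLpNorm_smul_le_mul_eLpNorm (p := 2) (q := 2) (r := 1) ((hq n).1.sub hw.1) hc.1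
  rw [mul_comm] at this
  exact (congrArg (eLpNorm · 1 ν) e).trans_le this

/-- Integration by parts for a function of `H¹(Ω)` that has a trace. -/
theorem HasTrace.integral_deriv_mul {w : H1} {γ : Lp ℝ 2 arcLength} (hw : HasTrace w γ) (i : Fin 2)
    {c : Plane → ℝ} (hc : ContDiff ℝ 1 c) :
    ∫ x, H1.deriv i w x * c x ∂area =
      -(∫ x, H1.fn w x * fderiv ℝ c x (basisVec i) ∂area) +
        ∫ x, γ x * (normal i x * c x) ∂arcLength := by
  obtain ⟨p, hp, h0, h1, h2⟩ := hw
  have hcd : Continuous fun x => fderiv ℝ c x (basisVec i) :=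
    (hc.continuous_fderiv one_ne_zero).clm_apply continuous_const
  have hpd : ∀ n, Continuous fun x => fderiv ℝ (p n) x (basisVec i) := fun n =>
    ((hp n).continuous_fderiv (by simp)).clm_apply continuous_const
  have hcn : MemLp (fun x => normal i x * c x) 2 arcLength :=
    (memLp_of_continuous_arcLength hc.continuous 2).of_le
      ((measurable_normal i).aestronglyMeasurable.mul hc.continuous.aestronglyMeasurable)
      (ae_of_all _ fun x => by
        rw [Real.norm_eq_abs, Real.norm_eq_abs, abs_mul]
        exact mul_le_of_le_one_left (abs_nonneg _) (abs_normal_le i x))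
  have l1 := tendsto_integral_mul_of_eLpNorm_two (fun n => memLp_of_continuous_area (hpd n) 2)
    (Lp.memLp _) (memLp_of_continuous_area hc.continuous 2) (h1 i)
  have l2 := tendsto_integral_mul_of_eLpNorm_two
    (fun n => memLp_of_continuous_area (hp n).continuous 2)
    (Lp.memLp _) (memLp_of_continuous_area hcd 2) h0
  have l3 := tendsto_integral_mul_of_eLpNorm_two
    (fun n => memLp_of_continuous_arcLength (hp n).continuous 2) (Lp.memLp _) hcn h2
  -- For the smooth approximants the identity is the divergence theorem applied to `p n * c`. All
  -- three terms converge, so it passes to the limit.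
  refine tendsto_nhds_unique l1 ((l2.neg.add l3).congr fun n => ?_)
  have hpc : ContDiff ℝ 1 fun x => p n x * c x := ((hp n).of_le (by simp)).mul hc
  have hd : ∀ x, fderiv ℝ (fun x => p n x * c x) x (basisVec i) =
      p n x * fderiv ℝ c x (basisVec i) + fderiv ℝ (p n) x (basisVec i) * c x := by
    intro x
    rw [fderiv_fun_mul ((hp n).differentiable (by simp) x) (hc.differentiable one_ne_zero x)]
    simp [mul_comm]
  have hdiv := integral_fderiv_area i hpc
  simp only [hd] at hdiv
  rw [integral_add] at hdiv
  · have : ∀ x, p n x * (normal i x * c x) = normal i x * (p n x * c x) := fun x => by ring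
    simp only [this]
    linarith
  · exact (memLp_of_continuous_area ((hp n).continuous.mul hcd) 1).integrable le_rfl
  · exact (memLp_of_continuous_area ((hpd n).mul hc.continuous) 1).integrable le_rfl

/-! ### Symmetry of weak second derivatives -/

theorem integrableOn_L2 (w : L2) : IntegrableOn w square :=
  (Lp.memLp w).integrable (by norm_num)

/-- The fundamental lemma of the calculus of variations, applied to `v - w` on the open square. -/
theorem eq_of_integral_test_eq {v w : L2}
    (h : ∀ ψ : Plane → ℝ, ContDiff ℝ ∞ ψ → HasCompactSupport ψ → tsupport ψ ⊆ square →
      ∫ x, v x * ψ x ∂area = ∫ x, w x * ψ x ∂area) : v = w := by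
  have h1 : ∀ᵐ x, x ∈ square → v x - w x = 0 := by
    refine isOpen_square.ae_eq_zero_of_integral_contDiff_smul_eq_zero
      ((integrableOn_L2 v).sub (integrableOn_L2 w)).locallyIntegrableOn fun ψ h1 h2 h3 => ?_
    have h4 : ∫ x in square, ψ x • (v x - w x) = ∫ x, ψ x • (v x - w x) := by
      refine setIntegral_eq_integral_of_forall_compl_eq_zero fun x hx => ?_
      rw [image_eq_zero_of_notMem_tsupport fun hx' => hx (h3 hx'), zero_smul]
    rw [← h4]
    have := h ψ h1 h2 h3
    rw [← sub_eq_zero, ← integral_sub (integrable_mul_test v h1.continuous h2)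
      (integrable_mul_test w h1.continuous h2)] at this
    refine Eq.trans ?_ this
    refine integral_congr_ae (ae_of_all _ fun x => ?_)
    simp only [smul_eq_mul]; ring
  refine Lp.ext ?_
  filter_upwards [(ae_restrict_iff' isOpen_square.measurableSet).2 h1] with x hx
  linarith

/-- Moving both derivatives onto a test function produces its second derivative, which is symmetric;
the two minus signs cancel. -/
theorem deriv_deriv_comm (V : H2) (i k : Fin 2) :
    H1.deriv k (H2.deriv i V) = H1.deriv i (H2.deriv k V) := by
  have key : ∀ i k : Fin 2, ∀ ψ : Plane → ℝ, ContDiff ℝ ∞ ψ → HasCompactSupport ψ →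
      tsupport ψ ⊆ square → ∫ x, H1.deriv k (H2.deriv i V) x * ψ x ∂area =
        ∫ x, H2.fn V x * fderiv ℝ (fderiv ℝ ψ) x (basisVec i) (basisVec k) ∂area := by
    intro i k ψ h1 h2 h3
    have e1 := (H2.deriv i V).2 k ψ h1 h2 h3
    have hd : ContDiff ℝ ∞ (fderiv ℝ ψ) := h1.fderiv_right (by simp)
    have e2 := V.2 i (fun x => fderiv ℝ ψ x (basisVec k)) (hd.clm_apply contDiff_const)
      (h2.fderiv_apply ℝ (basisVec k)) ((tsupport_fderiv_apply_subset ℝ (basisVec k)).trans h3)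
    have e3 : ∀ x, fderiv ℝ (fun x => fderiv ℝ ψ x (basisVec k)) x (basisVec i) =
        fderiv ℝ (fderiv ℝ ψ) x (basisVec i) (basisVec k) := by
      intro x
      rw [fderiv_clm_apply (hd.differentiable (by simp) x) (differentiableAt_const _)]
      simp
    simp only [e3] at e2
    exact (neg_eq_iff_eq_neg.2 e1).symm.trans e2.symm
  refine eq_of_integral_test_eq fun ψ h1 h2 h3 => ?_
  rw [key i k ψ h1 h2 h3, key k i ψ h1 h2 h3]
  refine integral_congr_ae (ae_of_all _ fun x => ?_)
  have : IsSymmSndFDerivAt ℝ ψ x := h1.contDiffAt.isSymmSndFDerivAt (by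
    rw [minSmoothness_of_isRCLikeNormedField]; exact WithTop.coe_le_coe.2 le_top)
  simp only [this.eq (basisVec i) (basisVec k)]

/-! ### Fourier coefficients of weak derivatives -/

/-- Integration over the square against a continuous function, as a functional on `L²(Ω)`. -/
def pairing (c : Plane → ℝ) (hc : Continuous c) : L2 →L[ℝ] ℝ :=
  innerSL ℝ ((memLp_of_continuous_area hc 2).toLp c)

theorem pairing_apply (c : Plane → ℝ) (hc : Continuous c) (w : L2) :
    pairing c hc w = ∫ x, w x * c x ∂area := by
  rw [pairing, innerSL_apply_apply, L2.inner_def]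
  refine integral_congr_ae ?_
  filter_upwards [(memLp_of_continuous_area hc 2).coeFn_toLp] with x hx
  simp [hx]

/-- The plane wave `sin (α · x)`. -/
def sineWave (α x : Plane) : ℝ := Real.sin (inner ℝ α x)

theorem contDiff_wave (α : Plane) : ContDiff ℝ 1 (wave α) :=
  Real.contDiff_cos.comp (contDiff_const.inner ℝ contDiff_id)

theorem contDiff_sineWave (α : Plane) : ContDiff ℝ 1 (sineWave α) :=
  Real.contDiff_sin.comp (contDiff_const.inner ℝ contDiff_id)

theorem hasFDerivAt_inner (α x : Plane) : HasFDerivAt (fun x => inner ℝ α x) (innerSL ℝ α) x :=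
  (innerSL ℝ α).hasFDerivAt

theorem inner_basisVec (α : Plane) (i : Fin 2) : inner ℝ α (basisVec i) = α i := by
  rw [basisVec, EuclideanSpace.inner_single_right]; simp

theorem fderiv_wave (α x : Plane) (i : Fin 2) :
    fderiv ℝ (wave α) x (basisVec i) = -(α i * sineWave α x) := by
  have h : HasFDerivAt (wave α) _ x := (hasFDerivAt_inner α x).cos
  rw [h.fderiv]
  simp [inner_basisVec, sineWave, mul_comm]

theorem fderiv_sineWave (α x : Plane) (i : Fin 2) :
    fderiv ℝ (sineWave α) x (basisVec i) = α i * wave α x := by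
  have h : HasFDerivAt (sineWave α) _ x := (hasFDerivAt_inner α x).sin
  rw [h.fderiv]
  simp [inner_basisVec, wave, mul_comm]

/-- The Fourier cosine coefficient at frequency `α`. -/
def cosCoeff (α : Plane) : L2 →L[ℝ] ℝ := pairing (wave α) (contDiff_wave α).continuous

/-- The Fourier sine coefficient at frequency `α`. -/
def sinCoeff (α : Plane) : L2 →L[ℝ] ℝ := pairing (sineWave α) (contDiff_sineWave α).continuous

/-- This is the first of two integrations by parts. It is applied to the stresses, so the boundary
term stays and will become the surface data; the second one, `HasTrace.sinCoeff_deriv`, is applied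
to the clamped displacement. -/
theorem HasTrace.cosCoeff_deriv {w : H1} {γ : Lp ℝ 2 arcLength} (hw : HasTrace w γ) (α : Plane)
    (i : Fin 2) : cosCoeff α (H1.deriv i w) = α i * sinCoeff α (H1.fn w) +
      ∫ x, γ x * (normal i x * wave α x) ∂arcLength := by
  rw [cosCoeff, sinCoeff, pairing_apply, pairing_apply, hw.integral_deriv_mul i (contDiff_wave α),
    ← integral_const_mul, ← integral_neg]
  congr 2
  funext x
  rw [fderiv_wave]; ring

theorem HasTrace.sinCoeff_deriv {w : H1} (hw : HasTrace w 0) (α : Plane)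
    (i : Fin 2) : sinCoeff α (H1.deriv i w) = -(α i * cosCoeff α (H1.fn w)) := by
  rw [cosCoeff, sinCoeff, pairing_apply, pairing_apply, hw.integral_deriv_mul i
    (contDiff_sineWave α), ← integral_const_mul]
  have h0 : ∫ x, (0 : Lp ℝ 2 arcLength) x * (normal i x * sineWave α x) ∂arcLength = 0 := by
    refine integral_eq_zero_of_ae ?_
    filter_upwards [Lp.coeFn_zero ℝ 2 arcLength] with x hx
    rw [hx]; simp
  rw [h0, add_zero]
  congr 2
  funext x
  rw [fderiv_sineWave]; ring

/-! ### The Lamé operator tested against a polarized plane wave -/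

theorem integrable_trace_mul (γ : Lp ℝ 2 arcLength) (α : Plane) (i : Fin 2) :
    Integrable (fun x => γ x * (normal i x * wave α x)) arcLength := by
  refine (Lp.memLp γ).integrable_mul (p := 2) (q := 2) ?_
  refine (memLp_of_continuous_arcLength (contDiff_wave α).continuous 2).of_le
    ((measurable_normal i).aestronglyMeasurable.mul
      (contDiff_wave α).continuous.aestronglyMeasurable) (ae_of_all _ fun x => ?_)
  rw [Real.norm_eq_abs, Real.norm_eq_abs, abs_mul]
  exact mul_le_of_le_one_left (abs_nonneg _) (abs_normal_le i x)

/-- The Fourier cosine coefficient of the Lamé operator, in a polarization `a` that makes the plane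
wave an eigenfunction. -/
theorem cosCoeff_lame {lam μ κ : ℝ} {α : Plane} {a : Fin 2 → ℝ}
    (hκ : ∀ i, (lam + μ) * (∑ k, a k * α k) * α i + μ * ‖α‖ ^ 2 * a i = κ * a i)
    {V : Fin 2 → H2} (hV : ∀ i, HasTrace (H2.toH1 (V i)) 0) {σ₁ σ₂ τ : Lp ℝ 2 arcLength}
    {X : Fin 2 → Plane → ℝ}
    (h₁ : HasTrace (normalStress lam μ V 0) σ₁) (h₂ : HasTrace (normalStress lam μ V 1) σ₂)
    (h₃ : HasTrace (shearStress μ V) τ)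
    (hX₁ : ∀ᵐ x ∂arcLength, normal 0 x * σ₁ x + normal 1 x * τ x = X 0 x)
    (hX₂ : ∀ᵐ x ∂arcLength, normal 1 x * σ₂ x + normal 0 x * τ x = X 1 x) :
    ∑ i, a i * cosCoeff α (μ • laplacian (V i) + (lam + μ) • H1.deriv i (divergence V)) =
      -κ * ∑ i, a i * cosCoeff α (H2.fn (V i)) +
        ∫ x, (∑ i, a i * X i x) * wave α x ∂arcLength := by
  have hn : ‖α‖ ^ 2 = α 0 ^ 2 + α 1 ^ 2 := by
    rw [EuclideanSpace.norm_sq_eq, Fin.sum_univ_two]; simp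
  have hB : ∫ x, (∑ i, a i * X i x) * wave α x ∂arcLength =
      a 0 * ((∫ x, σ₁ x * (normal 0 x * wave α x) ∂arcLength) +
        ∫ x, τ x * (normal 1 x * wave α x) ∂arcLength) +
      a 1 * ((∫ x, σ₂ x * (normal 1 x * wave α x) ∂arcLength) +
        ∫ x, τ x * (normal 0 x * wave α x) ∂arcLength) := by
    rw [← integral_add (integrable_trace_mul _ _ _) (integrable_trace_mul _ _ _),
      ← integral_add (integrable_trace_mul _ _ _) (integrable_trace_mul _ _ _),
      ← integral_const_mul, ← integral_const_mul, ← integral_add]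
    · refine integral_congr_ae ?_
      filter_upwards [hX₁, hX₂] with x e1 e2
      rw [Fin.sum_univ_two, ← e1, ← e2]; ring
    · exact ((integrable_trace_mul _ _ _).add (integrable_trace_mul _ _ _)).const_mul _
    · exact ((integrable_trace_mul _ _ _).add (integrable_trace_mul _ _ _)).const_mul _
  have d : ∀ i k, sinCoeff α (H1.fn (H2.deriv k (V i))) = -(α k * cosCoeff α (H2.fn (V i))) :=
    fun i k => (hV i).sinCoeff_deriv α k
  have s0 : ∀ j, H1.fn (normalStress lam μ V j) =
      lam • (H1.fn (H2.deriv 0 (V 0)) + H1.fn (H2.deriv 1 (V 1))) +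
        (2 * μ) • H1.fn (H2.deriv j (V j)) := by
    intro j; simp [normalStress, divergence, H1.fn, Fin.sum_univ_two]
  have s1 : ∀ i j, H1.deriv i (normalStress lam μ V j) =
      lam • (H1.deriv i (H2.deriv 0 (V 0)) + H1.deriv i (H2.deriv 1 (V 1))) +
        (2 * μ) • H1.deriv i (H2.deriv j (V j)) := by
    intro i j; simp [normalStress, divergence, H1.deriv, Fin.sum_univ_two]
  have t0 : H1.fn (shearStress μ V) =
      μ • (H1.fn (H2.deriv 1 (V 0)) + H1.fn (H2.deriv 0 (V 1))) := by
    simp [shearStress, H1.fn]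
  have t1 : ∀ i, H1.deriv i (shearStress μ V) =
      μ • (H1.deriv i (H2.deriv 1 (V 0)) + H1.deriv i (H2.deriv 0 (V 1))) := by
    intro i; simp [shearStress, H1.deriv]
  have dv : ∀ i, H1.deriv i (divergence V) =
      H1.deriv i (H2.deriv 0 (V 0)) + H1.deriv i (H2.deriv 1 (V 1)) := by
    intro i; simp [divergence, H1.deriv, Fin.sum_univ_two]
  -- The Lamé operator has components `∂₁σ₁ + ∂₂τ` and `∂₁τ + ∂₂σ₂`. Integrating the stresses by
  -- parts as a whole avoids traces of the individual derivatives of `V`.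
  have g1 := h₁.cosCoeff_deriv α 0
  have g2 := h₂.cosCoeff_deriv α 1
  have g3 := h₃.cosCoeff_deriv α 0
  have g4 := h₃.cosCoeff_deriv α 1
  simp only [s0, s1, t0, t1, map_add, map_smul, smul_eq_mul, d] at g1 g2 g3 g4
  -- The shear terms contain mixed derivatives in the order opposite to the one in the gradient of
  -- the divergence.
  rw [deriv_deriv_comm (V 1) 0 1] at g4
  rw [deriv_deriv_comm (V 0) 1 0] at g3
  have k0 := hκ 0
  have k1 := hκ 1
  rw [Fin.sum_univ_two, hn] at k0 k1
  rw [hB]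
  simp only [laplacian, dv, Fin.sum_univ_two, map_add, map_smul, smul_eq_mul]
  -- The symbol is a symmetric matrix acting on the coefficients of `V`. Transferred to `a`, it
  -- becomes multiplication by `κ`, by `k0` and `k1`.
  linear_combination a 0 * g1 + a 0 * g4 + a 1 * g2 + a 1 * g3 -
    cosCoeff α (H2.fn (V 0)) * k0 - cosCoeff α (H2.fn (V 1)) * k1

/-! ### Reduction to a harmonic oscillator in time -/

/-- Duhamel's formula for the harmonic oscillator. -/
theorem integral_sin_mul_oscillator {T : ℝ} (hT : 0 < T) (ν : ℝ) {y y' y'' : ℝ → ℝ}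
    (hy : ∀ t ∈ Icc 0 T, HasDerivWithinAt y (y' t) (Icc 0 T) t)
    (hy' : ∀ t ∈ Icc 0 T, HasDerivWithinAt y' (y'' t) (Icc 0 T) t)
    (hy'' : ContinuousOn y'' (Icc 0 T)) :
    ∫ t in Ioo 0 T, Real.sin (ν * (T - t)) * (y'' t + ν ^ 2 * y t) =
      ν * y T - ν * Real.cos (ν * T) * y 0 - Real.sin (ν * T) * y' 0 := by
  have hc : ContinuousOn y (Icc 0 T) := fun t ht => (hy t ht).continuousWithinAt
  have hc' : ContinuousOn y' (Icc 0 T) := fun t ht => (hy' t ht).continuousWithinAt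
  rw [← integral_Ioc_eq_integral_Ioo, ← intervalIntegral.integral_of_le hT.le]
  -- In the derivative of this antiderivative the terms in `y'` cancel. The factor `sin (ν(T-t))`
  -- vanishes at `T`, so the unknown `y' T` does not appear.
  rw [intervalIntegral.integral_eq_sub_of_hasDerivAt_of_le hT.le
    (f := fun t => ν * Real.cos (ν * (T - t)) * y t + Real.sin (ν * (T - t)) * y' t)]
  · simp; ring
  · fun_prop
  · intro t ht
    have hn := Icc_mem_nhds ht.1 ht.2
    have d1 := (hy t (Ioo_subset_Icc_self ht)).hasDerivAt hn
    have d2 := (hy' t (Ioo_subset_Icc_self ht)).hasDerivAt hn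
    have d3 : HasDerivAt (fun t => ν * (T - t)) (ν * -1) t :=
      ((hasDerivAt_id t).const_sub T).const_mul ν
    have d4 := ((d3.cos.const_mul ν).mul d1).add (d3.sin.mul d2)
    refine d4.congr_deriv ?_
    ring
  · refine ContinuousOn.intervalIntegrable ?_
    rw [uIcc_of_le hT.le]
    fun_prop

theorem hasDerivWithinAt_of_contDiffOn_two {E : Type*} [NormedAddCommGroup E] [NormedSpace ℝ E]
    {T : ℝ} (hT : 0 < T) {u : ℝ → E} (hu : ContDiffOn ℝ 2 u (Icc 0 T)) :
    (∀ t ∈ Icc 0 T, HasDerivWithinAt u (derivWithin u (Icc 0 T) t) (Icc 0 T) t) ∧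
    (∀ t ∈ Icc 0 T, HasDerivWithinAt (derivWithin u (Icc 0 T))
      (iteratedDerivWithin 2 u (Icc 0 T) t) (Icc 0 T) t) ∧
    ContinuousOn (iteratedDerivWithin 2 u (Icc 0 T)) (Icc 0 T) := by
  have hs := uniqueDiffOn_Icc hT
  refine ⟨fun t ht => (hu.differentiableOn (by norm_num) t ht).hasDerivWithinAt, fun t ht => ?_,
    hu.continuousOn_iteratedDerivWithin le_rfl hs⟩
  have h := (hu.differentiableOn_iteratedDerivWithin (m := 1) (by norm_num) hs) t ht
  rw [iteratedDerivWithin_one] at h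
  rw [show (2 : ℕ) = 1 + 1 from rfl, iteratedDerivWithin_succ, iteratedDerivWithin_one]
  exact h.hasDerivWithinAt

theorem cosCoeff_apply (α : Plane) (w : L2) : cosCoeff α w = ∫ x, w x * wave α x ∂area :=
  pairing_apply _ _ _

/-- The data `w i` are given as integrable functions only; agreeing almost everywhere with values of
`u` or its time derivative makes them square integrable, which lets the integral be split. -/
theorem integral_sum_mul_wave (α : Plane) (a : Fin 2 → ℝ) {w : Fin 2 → Plane → ℝ} {z : Fin 2 → L2}
    (h : ∀ i, ⇑(z i) =ᵐ[area] w i) :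
    ∫ x, (∑ i, a i * w i x) * wave α x ∂area = ∑ i, a i * cosCoeff α (z i) := by
  have hi : ∀ i, Integrable (fun x => z i x * wave α x) area := fun i =>
    (Lp.memLp (z i)).integrable_mul (memLp_of_continuous_area (contDiff_wave α).continuous 2)
  simp only [cosCoeff_apply]
  simp only [← integral_const_mul]
  rw [← integral_finsetSum _ fun i _ => (hi i).const_mul _]
  refine integral_congr_ae ?_
  filter_upwards [h 0, h 1] with x h0 h1
  simp only [Fin.sum_univ_two, h0, h1]
  ring

/-- The amplitude of a plane elastic wave with frequency `ν` and polarization `a`, computed from the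
data. -/
theorem modal_identity {lam μ T : ℝ} (hT : 0 < T) {I : Data T} {u : Fin 2 → ℝ → L2}
    {U : Fin 2 → ℝ → H2} {f : Fin 2 → L2} (hu : IsAdmissible T u U)
    (hsol : IsSolution lam μ I u U f) {α : Plane} {a : Fin 2 → ℝ} {ν : ℝ}
    (hν : ∀ i, (lam + μ) * (∑ k, a k * α k) * α i + μ * ‖α‖ ^ 2 * a i = ν ^ 2 * a i) :
    -Real.sin (ν * T) * ∫ x, (∑ i, a i * I.v₀ i x) * wave α x ∂area
      + ν * ∫ x, (∑ i, a i * I.uT i x) * wave α x ∂area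
      - ν * Real.cos (ν * T) * ∫ x, (∑ i, a i * I.u₀ i x) * wave α x ∂area
      - ∫ t in Ioo 0 T, ∫ x, Real.sin (ν * (T - t)) * (∑ i, a i * I.X i t x) * wave α x ∂arcLength
      = (∫ t in Ioo 0 T, I.φ (T - t) * Real.sin (ν * t)) * ∑ i, a i * cosCoeff α (f i) := by
  have hd := fun i => hasDerivWithinAt_of_contDiffOn_two hT (hu.contDiffOn i)
  set B := ∑ i, a i * cosCoeff α (f i) with hB
  have key := integral_sin_mul_oscillator hT ν
    (y := fun t => ∑ i, a i * cosCoeff α (u i t))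
    (y' := fun t => ∑ i, a i * cosCoeff α (derivWithin (u i) (Icc 0 T) t))
    (y'' := fun t => ∑ i, a i * cosCoeff α (iteratedDerivWithin 2 (u i) (Icc 0 T) t))
    (fun t ht => HasDerivWithinAt.fun_sum fun i _ =>
      ((cosCoeff α).hasFDerivAt.comp_hasDerivWithinAt t ((hd i).1 t ht)).const_mul (a i))
    (fun t ht => HasDerivWithinAt.fun_sum fun i _ =>
      ((cosCoeff α).hasFDerivAt.comp_hasDerivWithinAt t ((hd i).2.1 t ht)).const_mul (a i))
    (continuousOn_finsetSum _ fun i _ =>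
      continuousOn_const.mul ((cosCoeff α).continuous.comp_continuousOn (hd i).2.2))
  have : IsFiniteMeasure (time T) := by unfold time; infer_instance
  have hφ : Integrable (fun t => Real.sin (ν * (T - t)) * (I.φ t * B)) (time T) := by
    refine Integrable.bdd_mul (c := 1) (((Lp.memLp I.φ).integrable le_rfl).mul_const B)
      (by fun_prop) (ae_of_all _ fun t => Real.abs_sin_le_one _)
  have hint : IntegrableOn (fun t => Real.sin (ν * (T - t)) *
      ((∑ i, a i * cosCoeff α (iteratedDerivWithin 2 (u i) (Icc 0 T) t)) +
        ν ^ 2 * ∑ i, a i * cosCoeff α (u i t))) (Ioo 0 T) := by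
    refine (ContinuousOn.integrableOn_compact (K := Icc 0 T) isCompact_Icc ?_).mono_set
      Ioo_subset_Icc_self
    have c1 : ∀ i, ContinuousOn
        (fun t => cosCoeff α (iteratedDerivWithin 2 (u i) (Icc 0 T) t)) (Icc 0 T) := fun i =>
      (cosCoeff α).continuous.comp_continuousOn (hd i).2.2
    have c2 : ∀ i, ContinuousOn (fun t => cosCoeff α (u i t)) (Icc 0 T) := fun i =>
      (cosCoeff α).continuous.comp_continuousOn (hu.contDiffOn i).continuousOn
    fun_prop
  -- For almost every `t` the surface integral is `y'' + ν²y` minus the body force. After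
  -- multiplication by the sine, the first part is continuous on `[0, T]` and the second is
  -- integrable because `φ` is, so the time integral splits.
  have hX : ∫ t in Ioo 0 T, ∫ x, Real.sin (ν * (T - t)) * (∑ i, a i * I.X i t x) * wave α x
      ∂arcLength = (∫ t in Ioo 0 T, Real.sin (ν * (T - t)) *
        ((∑ i, a i * cosCoeff α (iteratedDerivWithin 2 (u i) (Icc 0 T) t)) +
          ν ^ 2 * ∑ i, a i * cosCoeff α (u i t))) -
        ∫ t in Ioo 0 T, Real.sin (ν * (T - t)) * (I.φ t * B) := by
    rw [← integral_sub hint hφ]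
    refine integral_congr_ae ?_
    change ∀ᵐ t ∂time T, _
    filter_upwards [hu.fn_eq 0, hu.fn_eq 1, hsol.equation 0, hsol.equation 1, hsol.clamped 0,
      hsol.clamped 1, hsol.stress] with t f0 f1 e0 e1 c0 c1 hs
    obtain ⟨σ₁, σ₂, τ, h1, h2, h3, h4, h5⟩ := hs
    have hl := cosCoeff_lame hν (V := fun i => U i t) (X := fun i => I.X i t)
      (Fin.forall_fin_two.2 ⟨c0, c1⟩) h1 h2 h3 h4 h5
    simp only [mul_assoc (Real.sin _)]
    rw [integral_const_mul]
    simp only [Fin.sum_univ_two, map_add, map_smul, smul_eq_mul] at hl hB ⊢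
    rw [e0, e1, hB, ← f0, ← f1]
    simp only [map_add, map_smul, smul_eq_mul]
    linear_combination -Real.sin (ν * (T - t)) * hl
  have hD : ∫ t in Ioo 0 T, Real.sin (ν * (T - t)) * (I.φ t * B) =
      (∫ t in Ioo 0 T, I.φ (T - t) * Real.sin (ν * t)) * B := by
    -- The reflection `t ↦ T - t` moves the shift from the sine to `φ`, the form in which `D₁` and
    -- `D₂` are defined.
    rw [← integral_mul_const]
    simp only [← integral_Ioc_eq_integral_Ioo, ← intervalIntegral.integral_of_le hT.le]
    have := intervalIntegral.integral_comp_sub_left (a := 0) (b := T)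
      (fun t => Real.sin (ν * (T - t)) * (I.φ t * B)) T
    rw [sub_self, sub_zero] at this
    rw [← this]
    refine intervalIntegral.integral_congr fun t _ => ?_
    simp only [sub_sub_cancel]
    ring
  rw [integral_sum_mul_wave α a hsol.velocity, integral_sum_mul_wave α a hsol.final,
    integral_sum_mul_wave α a hsol.initial, hX, key, hD]
  ring

end Elastic

end

/-! ### The longitudinal and transversal waves combined -/

theorem lemma1 (lam μ T : ℝ) (hμ : 0 < μ) (hlam : 0 < lam + 2 * μ) (hT : 0 < T)
    (I : Elastic.Data T) (u : Fin 2 → ℝ → Elastic.L2) (U : Fin 2 → ℝ → Elastic.H2)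
    (f : Fin 2 → Elastic.L2) (hu : Elastic.IsAdmissible T u U)
    (hsol : Elastic.IsSolution lam μ I u U f)
    (α : Elastic.Plane) (hα : α ≠ 0) (j : Fin 2) :
    2 * Elastic.D lam μ I α * ∫ x, f j x * Real.cos (inner ℝ α x) ∂Elastic.area =
      Elastic.g lam μ I α j := by
  have hn : ‖α‖ ^ 2 = α 0 ^ 2 + α 1 ^ 2 := by
    rw [EuclideanSpace.norm_sq_eq, Fin.sum_univ_two]; simp
  have h0 : ‖α‖ ≠ 0 := norm_ne_zero_iff.2 hα
  -- The longitudinal wave, polarized along `α`.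
  have hp := Elastic.modal_identity hT hu hsol (α := α) (a := fun i => α i)
    (ν := √(lam + 2 * μ) * ‖α‖) (fun i => by
      rw [mul_pow, Real.sq_sqrt hlam.le, Fin.sum_univ_two, hn]; ring)
  have hperp : ∀ (w : Fin 2 → Elastic.Plane → ℝ) (x : Elastic.Plane), Elastic.perp α j w x =
      ∑ i, (‖α‖ ^ 2 * (if i = j then 1 else 0) - α j * α i) * w i x := by
    intro w x
    fin_cases j <;> simp [Elastic.perp, Elastic.dot, Fin.sum_univ_two] <;> ring
  have hdiv : ∑ k, (‖α‖ ^ 2 * (if k = j then 1 else 0) - α j * α k) * α k = 0 := by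
    rw [Fin.sum_univ_two, hn]
    fin_cases j <;> simp <;> ring
  -- The transversal wave: the polarization is `|α|²` times the projection of `e_j` onto the
  -- orthogonal complement of `α`. By `hdiv` the term with `λ + μ` drops out.
  have hs := Elastic.modal_identity hT hu hsol (α := α)
    (a := fun i => ‖α‖ ^ 2 * (if i = j then 1 else 0) - α j * α i)
    (ν := √μ * ‖α‖) (fun i => by
      rw [hdiv, mul_pow, Real.sq_sqrt hμ.le]; ring)
  have e1 : Elastic.h₀ lam μ I α =
      Elastic.D₁ lam μ I α * ∑ i, α i * Elastic.cosCoeff α (f i) := hp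
  have e2 : Elastic.h μ I α j = Elastic.D₂ μ I α *
      ∑ i, (‖α‖ ^ 2 * (if i = j then 1 else 0) - α j * α i) * Elastic.cosCoeff α (f i) := by
    simp only [Elastic.h, hperp]
    exact hs
  have e3 : ∫ x, f j x * Real.cos (inner ℝ α x) ∂Elastic.area = Elastic.cosCoeff α (f j) :=
    (Elastic.cosCoeff_apply α (f j)).symm
  rw [e3, Elastic.g, Elastic.D, e1, e2]
  -- What remains is `α_j(α·F) + (|α|²F_j - α_j(α·F)) = |α|²F_j`, multiplied by `2 D₁ D₂ / |α|²`.
  field_simp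
  fin_cases j <;> simp [Fin.sum_univ_two] <;> ring
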